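/- Let $(\Omega,\mathcal F,\mathsf P)$ be a probability space, let $L^0$ be the space of real random variables (modulo $\mathsf P$-a.s. equality), and let $\mathcal P$ be the set of probability measures absolutely continuous with respect to $\mathsf P$, identified with their densities in $L^1(\mathsf P)$. For $\mathsf Q\in\mathcal P$ and $X\in L^0$ put $\mathsf E_{\mathsf Q}X=\mathsf E_{\mathsf Q}X^+-\mathsf E_{\mathsf Q}X^-\in[-\infty,\infty]$ with the convention $\infty-\infty=-\infty$. Let $u(X)=\inf_{\mathsf Q\in\mathcal D}\mathsf E_{\mathsf Q}X$ be a coherent utility function on $L^0$ with determining set $\mathcal D$, i.e. $\mathcal D\subseteq\mathcal P$ is nonempty and is the largest subset of $\mathcal P$ that represents $u$ in this way, and assume that $\mathcal D$ is weakly compact in $L^1(\mathsf P)$. Denote $$L^1_s(\mathcal D)=\Bigl\{X\in L^0:\lim_{n\to\infty}\sup_{\mathsf Q\in\mathcal D}\mathsf E_{\mathsf Q}\bigl(|X|I(|X|>n)\bigr)=0\Bigr\}.$$ For $B\subseteq L^0$ let $\mathcal R(B)=\{\mathsf Q\in\mathcal P:\mathsf E_{\mathsf Q}X\le0\text{ for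 all }X\in B\}$, and say that $B$ satisfies the no-good-deals condition (NGD) if there is no $X\in B$ with $u(X)>0$. Let $A\subseteq L^0$ be a convex set that contains zero and satisfies the NGD, put $\mathcal R=\mathcal R(A)$, let $F\in L^1_s(\mathcal D)$, and define the upper utility-based NGD price of $F$ at volume $v$ by $$\overline V(F,v)=\sup\{x\in\mathbb R:A-v(F-x)\text{ satisfies the NGD}\},\qquad v>0.$$ (i) The function $\overline V(F,\cdot)$ is finite, increasing (in the non-strict sense) and continuous on $(0,\infty)$. (ii) If $A$ is $\mathcal D$-consistent, i.e. there is a set $A'\subseteq L^1_s(\mathcal D)\cap A$ with $\mathcal D\cap\mathcal R=\mathcal D\cap\mathcal R(A')$, then $$\lim_{v\downarrow0}\overline V(F,v)=\sup_{\mathsf Q\in\mathcal D\cap\mathcal R}\mathsf E_{\mathsf Q}F.$$ (iii) The limit $\lim_{v\to\infty}\overline V(F,v)$ exists and $$\lim_{v\to\infty}\overline V(F,v)\le\sup_{\mathsf Q\in\mathcal D}\mathsf E_{\mathsf Q}F.$$ If, moreover, $\sup_{X\in A,\,\mathsf Q\in\mathcal D}|\mathsf E_{\mathsf Q}X|<\infty$,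 then $$\lim_{v\to\infty}\overline V(F,v)=\sup_{\mathsf Q\in\mathcal D}\mathsf E_{\mathsf Q}F.$$ -/

import Mathlib

open MeasureTheory Set Filter Topology
open scoped ENNReal

namespace CoherentPricing

noncomputable section

/-- Densities `dQ/dP` of the probability measures `Q` absolutely continuous with respect to `P`.
Such a measure is identified with its density, an element of `L¹(P)`. -/
def acProb {Ω : Type*} [MeasurableSpace Ω] (P : Measure Ω) : Set (Lp ℝ 1 P) :=
  {Z | (∀ᵐ ω ∂P, 0 ≤ Z ω) ∧ ∫ ω, Z ω ∂P = 1}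

/-- The measure with density `Z` with respect to `P`. -/
def measureOf {Ω : Type*} [MeasurableSpace Ω] {P : Measure Ω} (Z : Lp ℝ 1 P) : Measure Ω :=
  P.withDensity fun ω => ENNReal.ofReal (Z ω)

/-- `E_Q X = E_Q X⁺ - E_Q X⁻` for `Q` with density `Z`, with the convention `∞ - ∞ = -∞`
(subtraction in `EReal` satisfies `⊤ - ⊤ = ⊥`). -/
def expect {Ω : Type*} [MeasurableSpace Ω] {P : Measure Ω}
    (Z : Lp ℝ 1 P) (X : Ω →ₘ[P] ℝ) : EReal :=
  ((∫⁻ ω, ENNReal.ofReal (X ω) ∂(measureOf Z) : ℝ≥0∞) : EReal) -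
    ((∫⁻ ω, ENNReal.ofReal (-(X ω)) ∂(measureOf Z) : ℝ≥0∞) : EReal)

/-- The coherent utility `u(X) = inf_{Q ∈ D} E_Q X` on `L⁰`. -/
def utility {Ω : Type*} [MeasurableSpace Ω] {P : Measure Ω}
    (D : Set (Lp ℝ 1 P)) (X : Ω →ₘ[P] ℝ) : EReal :=
  ⨅ Z ∈ D, expect Z X

/-- `D` is the determining set of the coherent utility function `utility D`: it is the largest set
of probability measures absolutely continuous with respect to `P` that represents it. -/
structure IsDeterminingSet {Ω : Type*} [MeasurableSpace Ω] {P : Measure Ω}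
    (D : Set (Lp ℝ 1 P)) : Prop where
  nonempty : D.Nonempty
  subset_acProb : D ⊆ acProb P
  largest : ∀ D' ⊆ acProb P, (∀ X : Ω →ₘ[P] ℝ, utility D' X = utility D X) → D' ⊆ D

/-- Compactness in the weak topology of `L¹(P)`. -/
def IsWeaklyCompact {Ω : Type*} [MeasurableSpace Ω] {P : Measure Ω}
    (D : Set (Lp ℝ 1 P)) : Prop :=
  IsCompact (toWeakSpace ℝ (Lp ℝ 1 P) '' D)

/-- The strong space `L_s¹(D)`: those `X` with
`sup_{Q ∈ D} E_Q (|X| I(|X| > n)) → 0` as `n → ∞`. -/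
def strongL1 {Ω : Type*} [MeasurableSpace Ω] {P : Measure Ω}
    (D : Set (Lp ℝ 1 P)) : Set (Ω →ₘ[P] ℝ) :=
  {X | Tendsto (fun n : ℕ => ⨆ Z ∈ D,
      ∫⁻ ω in {ω | (n : ℝ) < |X ω|}, ENNReal.ofReal |X ω| ∂(measureOf Z)) atTop (𝓝 0)}

/-- The set `R(A)` of risk-neutral measures: `E_Q X ≤ 0` for every `X ∈ A`. -/
def riskNeutral {Ω : Type*} [MeasurableSpace Ω] {P : Measure Ω}
    (A : Set (Ω →ₘ[P] ℝ)) : Set (Lp ℝ 1 P) :=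
  {Z | Z ∈ acProb P ∧ ∀ X ∈ A, expect Z X ≤ 0}

/-- `A` is `D`-consistent: the part of `A` lying in `L_s¹(D)` has a subset that already determines
`D ∩ R(A)`. -/
def IsConsistent {Ω : Type*} [MeasurableSpace Ω] {P : Measure Ω}
    (D : Set (Lp ℝ 1 P)) (A : Set (Ω →ₘ[P] ℝ)) : Prop :=
  ∃ A' ⊆ strongL1 D ∩ A, D ∩ riskNeutral A = D ∩ riskNeutral A'

/-- The (utility-based) no-good-deals condition for the model with determining set `D` and set `A`
of attainable incomes. -/
def NGD {Ω : Type*} [MeasurableSpace Ω] {P : Measure Ω}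
    (D : Set (Lp ℝ 1 P)) (A : Set (Ω →ₘ[P] ℝ)) : Prop :=
  ¬ ∃ X ∈ A, 0 < utility D X

/-- The upper utility-based NGD price function
`V̄(F, v) = sup {x ∈ ℝ : the model with A - v(F - x) satisfies the NGD}`, with the supremum taken in
the extended reals. -/
def upperPrice {Ω : Type*} [MeasurableSpace Ω] {P : Measure Ω}
    (D : Set (Lp ℝ 1 P)) (A : Set (Ω →ₘ[P] ℝ)) (F : Ω →ₘ[P] ℝ) (v : ℝ) : EReal :=
  sSup ((fun x : ℝ => (x : EReal)) ''
    {x : ℝ | NGD D ((fun X : Ω →ₘ[P] ℝ => X - v • (F - AEEqFun.const Ω x)) '' A)})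

end

end CoherentPricing

/-! ### Expectations under a density, with infinite values allowed -/

namespace CoherentPricing

variable {Ω : Type*} [MeasurableSpace Ω] {P : Measure Ω}

/-! Put `g v = sup_{X ∈ A} u(X - vF)`. Shifting the price by `x` adds the constant `vx` to the
position, so `A - v(F - x)` satisfies the NGD iff `g v + vx ≤ 0`. Hence the upper price is `-g v /
v` (`upperPrice_eq`), and everything is read off from `g`.

Since `E_Q F` is bounded over `D`, `g` is finite and Lipschitz (`continuous_penalty`); since `A` is
convex and contains zero, `g v / v` is decreasing (`penalty_div_le`). This gives (i), and both
limits exist by monotonicity.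

At zero the limit is the infimum of the prices. A risk-neutral `Q` in `D` gives `g v ≤ -v E_Q F`, so
the limit is at least `E_Q F`. Conversely, for `y` below the limit no `X - v(F - y)` is a good deal,
and a minimax argument (`exists_mem_riskNeutral`) yields one `Q` in `D` that prices `A'`
nonpositively and `F` at `y` or more. It combines Hahn–Banach in finite dimension, weak compactness
of `D`, and weak continuity of `Q ↦ E_Q X` for `X` in the strong space; consistency replaces `A'` by
`A`.

At infinity, the position `X = 0` bounds the price by `sup E_Q F`. If expectations over `A` and `D`
are bounded by `K`, then `g v ≤ K - v E_Q F`, and the error `K / v` vanishes. -/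

theorem measureOf_absolutelyContinuous (Z : Lp ℝ 1 P) : measureOf Z ≪ P :=
  withDensity_absolutelyContinuous _ _

theorem isProbabilityMeasure_measureOf {Z : Lp ℝ 1 P} (hZ : Z ∈ acProb P) :
    IsProbabilityMeasure (measureOf Z) := by
  constructor
  rw [measureOf, withDensity_apply _ MeasurableSet.univ, Measure.restrict_univ,
    ← ofReal_integral_eq_lintegral_ofReal (L1.integrable_coeFn Z) hZ.1, hZ.2, ENNReal.ofReal_one]

theorem aestronglyMeasurable_measureOf (Z : Lp ℝ 1 P) (X : Ω →ₘ[P] ℝ) :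
    AEStronglyMeasurable X (measureOf Z) :=
  X.aestronglyMeasurable.mono_ac (measureOf_absolutelyContinuous Z)

theorem expect_congr {Z : Lp ℝ 1 P} {X : Ω →ₘ[P] ℝ} {f : Ω → ℝ} (h : X =ᵐ[P] f) :
    expect Z X = ((∫⁻ ω, ENNReal.ofReal (f ω) ∂(measureOf Z) : ℝ≥0∞) : EReal) -
      ((∫⁻ ω, ENNReal.ofReal (-(f ω)) ∂(measureOf Z) : ℝ≥0∞) : EReal) := by
  have h' : X =ᵐ[measureOf Z] f := (measureOf_absolutelyContinuous Z).ae_eq h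
  rw [expect]
  congr 2 <;> refine lintegral_congr_ae ?_ <;> filter_upwards [h'] with ω hω <;> rw [hω]

theorem expect_of_integrable {Z : Lp ℝ 1 P} {X : Ω →ₘ[P] ℝ} (h : Integrable X (measureOf Z)) :
    expect Z X = ((∫ ω, X ω ∂(measureOf Z) : ℝ) : EReal) := by
  rw [expect, integral_eq_lintegral_pos_part_sub_lintegral_neg_part h, EReal.coe_sub,
    EReal.coe_ennreal_toReal, EReal.coe_ennreal_toReal]
  · exact h.neg.lintegral_lt_top.ne
  · exact h.lintegral_lt_top.ne

theorem integrable_of_lintegral_ne_top {μ : Measure Ω} {f : Ω → ℝ} (hf : AEStronglyMeasurable f μ)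
    (hp : ∫⁻ ω, ENNReal.ofReal (f ω) ∂μ ≠ ⊤) (hn : ∫⁻ ω, ENNReal.ofReal (-f ω) ∂μ ≠ ⊤) :
    Integrable f μ := by
  refine ⟨hf, ?_⟩
  rw [hasFiniteIntegral_iff_norm]
  refine lt_of_le_of_lt (lintegral_mono (g := fun ω => ENNReal.ofReal (f ω) +
    ENNReal.ofReal (-f ω)) fun ω => ?_) ?_
  · rcases le_total 0 (f ω) with h | h
    · simp [abs_of_nonneg h]
    · simp [abs_of_nonpos h]
  · rw [lintegral_add_left' hf.aemeasurable.ennreal_ofReal]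
    exact ENNReal.add_lt_top.2 ⟨hp.lt_top, hn.lt_top⟩

theorem coeFn_add_measureOf (Z : Lp ℝ 1 P) (X Y : Ω →ₘ[P] ℝ) :
    ((X + Y : Ω →ₘ[P] ℝ) : Ω → ℝ) =ᵐ[measureOf Z] X + Y :=
  (measureOf_absolutelyContinuous Z).ae_eq (AEEqFun.coeFn_add X Y)

theorem coeFn_smul_measureOf (Z : Lp ℝ 1 P) (c : ℝ) (X : Ω →ₘ[P] ℝ) :
    ((c • X : Ω →ₘ[P] ℝ) : Ω → ℝ) =ᵐ[measureOf Z] c • X :=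
  (measureOf_absolutelyContinuous Z).ae_eq (AEEqFun.coeFn_smul c X)

theorem integrable_add {Z : Lp ℝ 1 P} {X Y : Ω →ₘ[P] ℝ} (hX : Integrable X (measureOf Z))
    (hY : Integrable Y (measureOf Z)) :
    Integrable (X + Y : Ω →ₘ[P] ℝ) (measureOf Z) :=
  (hX.add hY).congr (coeFn_add_measureOf Z X Y).symm

theorem integrable_smul {Z : Lp ℝ 1 P} {X : Ω →ₘ[P] ℝ} (c : ℝ)
    (hX : Integrable X (measureOf Z)) :
    Integrable (c • X : Ω →ₘ[P] ℝ) (measureOf Z) :=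
  (hX.smul c).congr (coeFn_smul_measureOf Z c X).symm

theorem integral_add_aeeqFun {Z : Lp ℝ 1 P} {X Y : Ω →ₘ[P] ℝ} (hX : Integrable X (measureOf Z))
    (hY : Integrable Y (measureOf Z)) :
    ∫ ω, (X + Y : Ω →ₘ[P] ℝ) ω ∂(measureOf Z) =
      ∫ ω, X ω ∂(measureOf Z) + ∫ ω, Y ω ∂(measureOf Z) := by
  rw [integral_congr_ae (coeFn_add_measureOf Z X Y)]
  exact integral_add hX hY

theorem integral_smul_aeeqFun (Z : Lp ℝ 1 P) (X : Ω →ₘ[P] ℝ) (c : ℝ) :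
    ∫ ω, (c • X : Ω →ₘ[P] ℝ) ω ∂(measureOf Z) = c * ∫ ω, X ω ∂(measureOf Z) := by
  rw [integral_congr_ae (coeFn_smul_measureOf Z c X)]
  exact integral_smul c _

theorem integrable_const_aeeqFun {Z : Lp ℝ 1 P} (hZ : Z ∈ acProb P) (x : ℝ) :
    Integrable (AEEqFun.const Ω x : Ω →ₘ[P] ℝ) (measureOf Z) := by
  have := isProbabilityMeasure_measureOf hZ
  exact (integrable_const x).congr
    ((measureOf_absolutelyContinuous Z).ae_eq (AEEqFun.coeFn_const Ω x)).symm

theorem integral_const_aeeqFun {Z : Lp ℝ 1 P} (hZ : Z ∈ acProb P) (x : ℝ) :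
    ∫ ω, (AEEqFun.const Ω x : Ω →ₘ[P] ℝ) ω ∂(measureOf Z) = x := by
  have := isProbabilityMeasure_measureOf hZ
  rw [integral_congr_ae ((measureOf_absolutelyContinuous Z).ae_eq (AEEqFun.coeFn_const Ω x))]
  simp

/-- If `X⁻` is not integrable, neither is `(X + Y)⁻`, as `X⁻ ≤ (X + Y)⁻ + Y⁺`, and the left side is
`⊥` by the convention `∞ - ∞ = -∞`. If only `X⁺` is not integrable, the right side is `⊤`. Otherwise
this is linearity of the integral. -/
theorem expect_add_le {Z : Lp ℝ 1 P} (X : Ω →ₘ[P] ℝ) {Y : Ω →ₘ[P] ℝ}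
    (hY : Integrable Y (measureOf Z)) :
    expect Z (X + Y) ≤ expect Z X + ((∫ ω, Y ω ∂(measureOf Z) : ℝ) : EReal) := by
  by_cases hn : ∫⁻ ω, ENNReal.ofReal (-X ω) ∂(measureOf Z) = ⊤
  · suffices h : ∫⁻ ω, ENNReal.ofReal (-(X + Y : Ω →ₘ[P] ℝ) ω) ∂(measureOf Z) = ⊤ by
      rw [expect, h, EReal.coe_ennreal_top, EReal.sub_top]
      exact bot_le
    by_contra h
    refine ((lintegral_mono_ae (g := fun ω => ENNReal.ofReal (-(X + Y : Ω →ₘ[P] ℝ) ω) +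
      ENNReal.ofReal (Y ω)) ?_).trans_lt ?_).ne hn
    · filter_upwards [coeFn_add_measureOf Z X Y] with ω hω
      rw [hω]
      refine le_trans (ENNReal.ofReal_le_ofReal ?_) ENNReal.ofReal_add_le
      simp
    · rw [lintegral_add_left' (f := fun ω => ENNReal.ofReal (-(X + Y : Ω →ₘ[P] ℝ) ω))
        (aestronglyMeasurable_measureOf Z _).aemeasurable.neg.ennreal_ofReal]
      exact ENNReal.add_lt_top.2 ⟨Ne.lt_top h, hY.lintegral_lt_top⟩
  by_cases hp : ∫⁻ ω, ENNReal.ofReal (X ω) ∂(measureOf Z) = ⊤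
  · have : expect Z X = ⊤ := by
      rw [expect, hp, EReal.coe_ennreal_top, EReal.top_sub]
      simpa using hn
    rw [this, EReal.top_add_coe]
    exact le_top
  · have hX := integrable_of_lintegral_ne_top (aestronglyMeasurable_measureOf Z X) hp hn
    rw [expect_of_integrable hX, expect_of_integrable (integrable_add hX hY),
      integral_add_aeeqFun hX hY, EReal.coe_add]

theorem expect_add {Z : Lp ℝ 1 P} (X : Ω →ₘ[P] ℝ) {Y : Ω →ₘ[P] ℝ}
    (hY : Integrable Y (measureOf Z)) :
    expect Z (X + Y) = expect Z X + ((∫ ω, Y ω ∂(measureOf Z) : ℝ) : EReal) := by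
  refine le_antisymm (expect_add_le X hY) ?_
  -- The reverse inequality is the same bound with `-Y` added to `X + Y`.
  have h := expect_add_le (X + Y) (integrable_smul (-1) hY)
  rw [integral_smul_aeeqFun, show X + Y + (-1 : ℝ) • Y = X by simp] at h
  refine (add_le_add_left h _).trans_eq ?_
  rw [add_assoc, ← EReal.coe_add]
  simp

theorem expect_smul {c : ℝ} (hc : 0 < c) (Z : Lp ℝ 1 P) (X : Ω →ₘ[P] ℝ) :
    expect Z (c • X) = (c : EReal) * expect Z X := by
  rw [expect_congr (AEEqFun.coeFn_smul c X), expect,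
    EReal.mul_sub_of_nonneg_of_ne_top (by exact_mod_cast hc.le) (EReal.coe_ne_top c)]
  have hc' : (c : EReal) = ((ENNReal.ofReal c : ℝ≥0∞) : EReal) := by
    rw [EReal.coe_ennreal_ofReal, max_eq_left hc.le]
  rw [hc', ← EReal.coe_ennreal_mul, ← EReal.coe_ennreal_mul,
    ← lintegral_const_mul'' _ (aestronglyMeasurable_measureOf Z X).aemeasurable.ennreal_ofReal,
    ← lintegral_const_mul'' (f := fun ω => ENNReal.ofReal (-X ω)) _
      (aestronglyMeasurable_measureOf Z X).aemeasurable.neg.ennreal_ofReal]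
  simp only [Pi.smul_apply, smul_eq_mul, ← ENNReal.ofReal_mul hc.le, mul_neg]

/-! ### Convex combinations of densities and convexity of the determining set -/

theorem measureOf_combination {Z₁ Z₂ : Lp ℝ 1 P} (h₁ : Z₁ ∈ acProb P) (h₂ : Z₂ ∈ acProb P)
    {a b : ℝ} (ha : 0 ≤ a) (hb : 0 ≤ b) :
    measureOf (a • Z₁ + b • Z₂) =
      ENNReal.ofReal a • measureOf Z₁ + ENNReal.ofReal b • measureOf Z₂ := by
  have hm : ∀ Z : Lp ℝ 1 P, Measurable fun ω => ENNReal.ofReal (Z ω) := fun Z =>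
    (Lp.stronglyMeasurable Z).measurable.ennreal_ofReal
  rw [measureOf, measureOf, measureOf, ← withDensity_smul _ (hm Z₁), ← withDensity_smul _ (hm Z₂),
    ← withDensity_add_left ((hm Z₁).const_smul _)]
  refine withDensity_congr_ae ?_
  filter_upwards [Lp.coeFn_add (a • Z₁) (b • Z₂), Lp.coeFn_smul a Z₁, Lp.coeFn_smul b Z₂, h₁.1,
    h₂.1] with ω e e₁ e₂ p₁ p₂
  simp only [e, Pi.add_apply, e₁, e₂, Pi.smul_apply, smul_eq_mul]
  rw [ENNReal.ofReal_add (mul_nonneg ha p₁) (mul_nonneg hb p₂), ENNReal.ofReal_mul ha,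
    ENNReal.ofReal_mul hb]

theorem convex_acProb : Convex ℝ (acProb P) := by
  intro Z₁ h₁ Z₂ h₂ a b ha hb hab
  have e : ((a • Z₁ + b • Z₂ : Lp ℝ 1 P) : Ω → ℝ) =ᵐ[P] fun ω => a * Z₁ ω + b * Z₂ ω := by
    filter_upwards [Lp.coeFn_add (a • Z₁) (b • Z₂), Lp.coeFn_smul a Z₁, Lp.coeFn_smul b Z₂]
      with ω e e₁ e₂
    simp only [e, Pi.add_apply, e₁, e₂, Pi.smul_apply, smul_eq_mul]
  constructor
  · filter_upwards [e, h₁.1, h₂.1] with ω e p₁ p₂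
    rw [e]
    positivity
  · rw [integral_congr_ae e, integral_add ((L1.integrable_coeFn Z₁).const_mul a)
      ((L1.integrable_coeFn Z₂).const_mul b), integral_const_mul, integral_const_mul, h₁.2, h₂.2,
      mul_one, mul_one, hab]

theorem integral_measureOf_combination {Z₁ Z₂ : Lp ℝ 1 P} (h₁ : Z₁ ∈ acProb P)
    (h₂ : Z₂ ∈ acProb P) {a b : ℝ} (ha : 0 ≤ a) (hb : 0 ≤ b) {X : Ω →ₘ[P] ℝ}
    (i₁ : Integrable X (measureOf Z₁)) (i₂ : Integrable X (measureOf Z₂)) :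
    ∫ ω, X ω ∂(measureOf (a • Z₁ + b • Z₂)) =
      a * ∫ ω, X ω ∂(measureOf Z₁) + b * ∫ ω, X ω ∂(measureOf Z₂) := by
  rw [measureOf_combination h₁ h₂ ha hb, integral_add_measure (i₁.smul_measure (by simp))
    (i₂.smul_measure (by simp)), integral_smul_measure, integral_smul_measure,
    ENNReal.toReal_ofReal ha, ENNReal.toReal_ofReal hb, smul_eq_mul, smul_eq_mul]

theorem coe_le_ennreal_sub_iff {r : ℝ} {p n : ℝ≥0∞} :
    (r : EReal) ≤ (p : EReal) - (n : EReal) ↔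
      n ≠ ⊤ ∧ (p = ⊤ ∨ r ≤ p.toReal - n.toReal) := by
  by_cases hn : n = ⊤
  · simp [hn]
  by_cases hp : p = ⊤
  · rw [hp, EReal.coe_ennreal_top, EReal.top_sub (by simpa using hn)]
    simp [hn]
  · rw [← EReal.coe_ennreal_toReal hp, ← EReal.coe_ennreal_toReal hn, ← EReal.coe_sub,
      EReal.coe_le_coe_iff]
    simp [hn, hp]

/-- A finite lower bound forces both negative parts to be integrable, so the combination never meets
`∞ - ∞`. The weights are strictly positive so that one infinite positive part makes the combined one
infinite. -/
theorem coe_le_expect_combination {Z₁ Z₂ : Lp ℝ 1 P} (h₁ : Z₁ ∈ acProb P)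
    (h₂ : Z₂ ∈ acProb P) {a b : ℝ} (ha : 0 < a) (hb : 0 < b) (hab : a + b = 1) {X : Ω →ₘ[P] ℝ}
    {r : ℝ} (i₁ : (r : EReal) ≤ expect Z₁ X) (i₂ : (r : EReal) ≤ expect Z₂ X) :
    (r : EReal) ≤ expect (a • Z₁ + b • Z₂) X := by
  rw [expect, coe_le_ennreal_sub_iff] at i₁ i₂ ⊢
  rw [measureOf_combination h₁ h₂ ha.le hb.le]
  simp only [lintegral_add_measure, lintegral_smul_measure, smul_eq_mul]
  obtain ⟨n₁, p₁⟩ := i₁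
  obtain ⟨n₂, p₂⟩ := i₂
  have m₁ := ENNReal.mul_ne_top (ENNReal.ofReal_ne_top (r := a)) n₁
  have m₂ := ENNReal.mul_ne_top (ENNReal.ofReal_ne_top (r := b)) n₂
  refine ⟨ENNReal.add_ne_top.2 ⟨m₁, m₂⟩, ?_⟩
  by_cases q₁ : ∫⁻ ω, ENNReal.ofReal (X ω) ∂(measureOf Z₁) = ⊤
  · left
    rw [q₁, ENNReal.mul_top (by simpa using ha), top_add]
  by_cases q₂ : ∫⁻ ω, ENNReal.ofReal (X ω) ∂(measureOf Z₂) = ⊤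
  · left
    rw [q₂, ENNReal.mul_top (by simpa using hb), add_top]
  right
  replace p₁ := p₁.resolve_left q₁
  replace p₂ := p₂.resolve_left q₂
  rw [ENNReal.toReal_add (ENNReal.mul_ne_top ENNReal.ofReal_ne_top q₁)
    (ENNReal.mul_ne_top ENNReal.ofReal_ne_top q₂), ENNReal.toReal_add m₁ m₂]
  simp only [ENNReal.toReal_mul, ENNReal.toReal_ofReal ha.le, ENNReal.toReal_ofReal hb.le]
  have := mul_le_mul_of_nonneg_left p₁ ha.le
  have := mul_le_mul_of_nonneg_left p₂ hb.le
  have : a * r + b * r = r := by rw [← add_mul, hab, one_mul]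
  linarith

/-- A determining set is convex. -/
theorem IsDeterminingSet.convex {D : Set (Lp ℝ 1 P)} (hD : IsDeterminingSet D) : Convex ℝ D := by
  rw [convex_iff_forall_pos]
  intro Z₁ h₁ Z₂ h₂ a b ha hb hab
  have p₁ := hD.subset_acProb h₁
  have p₂ := hD.subset_acProb h₂
  -- Adjoining the combination does not lower the infimum, since it respects every real level below
  -- `u(X)`; maximality of `D` then puts it in `D`.
  refine hD.largest (insert (a • Z₁ + b • Z₂) D) ?_ ?_ (mem_insert _ _)
  · exact insert_subset (convex_acProb p₁ p₂ ha.le hb.le hab) hD.subset_acProb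
  · intro X
    rw [utility, iInf_insert]
    exact inf_eq_right.2 (EReal.ge_of_forall_gt_iff_ge.1 fun r hr =>
      coe_le_expect_combination p₁ p₂ ha hb hab (hr.le.trans (iInf₂_le _ h₁))
      (hr.le.trans (iInf₂_le _ h₂)))

/-! ### Cash invariance and homogeneity of the utility -/

section Utility

variable {D : Set (Lp ℝ 1 P)}

theorem utility_add_le {X Y : Ω →ₘ[P] ℝ} {c : ℝ}
    (hi : ∀ Z ∈ D, Integrable Y (measureOf Z)) (hc : ∀ Z ∈ D, ∫ ω, Y ω ∂(measureOf Z) ≤ c) :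
    utility D (X + Y) ≤ utility D X + (c : EReal) := by
  -- With `c` moved to the left, the bound can be checked for each measure separately.
  have h : utility D (X + Y) - (c : EReal) ≤ utility D X := by
    refine le_iInf₂ fun Z hZ => EReal.sub_le_of_le_add ?_
    refine (iInf₂_le Z hZ).trans ?_
    rw [expect_add X (hi Z hZ)]
    exact add_le_add_right (by exact_mod_cast hc Z hZ) _
  calc utility D (X + Y) = utility D (X + Y) - (c : EReal) + (c : EReal) :=
        EReal.sub_add_cancel.symm
    _ ≤ _ := add_le_add_left h _

theorem utility_add_const (hD : D ⊆ acProb P) (X : Ω →ₘ[P] ℝ) (x : ℝ) :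
    utility D (X + AEEqFun.const Ω x) = utility D X + (x : EReal) := by
  have key : ∀ (Y : Ω →ₘ[P] ℝ) (y : ℝ),
      utility D (Y + AEEqFun.const Ω y) ≤ utility D Y + (y : EReal) := fun Y y =>
    utility_add_le (fun Z hZ => integrable_const_aeeqFun (hD hZ) y)
      fun Z hZ => (integral_const_aeeqFun (hD hZ) y).le
  refine le_antisymm (key X x) ?_
  have h := key (X + AEEqFun.const Ω x) (-x)
  rw [add_assoc, show (AEEqFun.const Ω x + AEEqFun.const Ω (-x) : Ω →ₘ[P] ℝ) = 0 by
    change AEEqFun.const Ω x + -(AEEqFun.const Ω x) = 0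
    exact add_neg_cancel _, add_zero] at h
  refine (add_le_add_left h _).trans_eq ?_
  rw [add_assoc, ← EReal.coe_add]
  simp

theorem utility_smul_le {c : ℝ} (hc : 0 < c) (X : Ω →ₘ[P] ℝ) :
    utility D (c • X) ≤ (c : EReal) * utility D X := by
  rw [← EReal.div_le_iff_le_mul (by exact_mod_cast hc) (EReal.coe_ne_top c)]
  refine le_iInf₂ fun Z hZ => ?_
  rw [EReal.div_le_iff_le_mul (by exact_mod_cast hc) (EReal.coe_ne_top c), ← expect_smul hc]
  exact iInf₂_le Z hZ

end Utility

/-! ### The strong space: uniform bounds and weak continuity -/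

section StrongL1

variable {D : Set (Lp ℝ 1 P)} {F : Ω →ₘ[P] ℝ}

theorem measurableSet_lt_abs (F : Ω →ₘ[P] ℝ) (r : ℝ) :
    MeasurableSet {ω | r < |F ω|} :=
  measurableSet_lt measurable_const F.measurable.abs

theorem exists_lintegral_le_of_mem_strongL1 (hD : D ⊆ acProb P) (hF : F ∈ strongL1 D) :
    ∃ C : ℝ, 0 ≤ C ∧ ∀ Z ∈ D, ∫⁻ ω, ENNReal.ofReal |F ω| ∂(measureOf Z) ≤ ENNReal.ofReal C := by
  obtain ⟨n, hn⟩ := ((tendsto_order.1 hF).2 1 one_pos).exists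
  -- Beyond level `n` the tail contributes at most `1` uniformly over `D`; below it `|F| ≤ n`.
  refine ⟨1 + n, by positivity, fun Z hZ => ?_⟩
  have := isProbabilityMeasure_measureOf (hD hZ)
  have hm := measurableSet_lt_abs F n
  rw [← lintegral_add_compl _ hm, ENNReal.ofReal_add zero_le_one n.cast_nonneg, ENNReal.ofReal_one]
  refine add_le_add ((le_iSup₂ (f := fun (Z : Lp ℝ 1 P) (_ : Z ∈ D) =>
    ∫⁻ ω in {ω | (n : ℝ) < |F ω|}, ENNReal.ofReal |F ω| ∂(measureOf Z)) Z hZ).trans hn.le) ?_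
  calc ∫⁻ ω in {ω | (n : ℝ) < |F ω|}ᶜ, ENNReal.ofReal |F ω| ∂(measureOf Z)
      ≤ ∫⁻ ω in {ω | (n : ℝ) < |F ω|}ᶜ, ENNReal.ofReal n ∂(measureOf Z) :=
        setLIntegral_mono' hm.compl fun ω hω => ENNReal.ofReal_le_ofReal (not_lt.1 hω)
    _ ≤ ∫⁻ ω, ENNReal.ofReal n ∂(measureOf Z) := setLIntegral_le_lintegral _ _
    _ = ENNReal.ofReal n := by simp

theorem exists_bound_of_mem_strongL1 (hD : D ⊆ acProb P) (hF : F ∈ strongL1 D) :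
    ∃ C : ℝ, 0 ≤ C ∧ ∀ Z ∈ D, Integrable F (measureOf Z) ∧ |∫ ω, F ω ∂(measureOf Z)| ≤ C := by
  obtain ⟨C, hC, h⟩ := exists_lintegral_le_of_mem_strongL1 hD hF
  refine ⟨C, hC, fun Z hZ => ?_⟩
  have h' : ∫⁻ ω, ENNReal.ofReal ‖F ω‖ ∂(measureOf Z) ≤ ENNReal.ofReal C := h Z hZ
  refine ⟨⟨aestronglyMeasurable_measureOf Z F, ?_⟩, ?_⟩
  · rw [hasFiniteIntegral_iff_norm]
    exact h'.trans_lt ENNReal.ofReal_lt_top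
  · refine (norm_integral_le_lintegral_norm F).trans ?_
    exact ENNReal.toReal_le_of_le_ofReal hC h'

theorem integrable_of_mem_strongL1 (hD : D ⊆ acProb P) (hF : F ∈ strongL1 D) {Z : Lp ℝ 1 P}
    (hZ : Z ∈ D) : Integrable F (measureOf Z) :=
  let ⟨_, _, h⟩ := exists_bound_of_mem_strongL1 hD hF
  (h Z hZ).1

/-- Integration of a bounded function against the measure with a given density is weakly
continuous in the density. -/
theorem continuous_integral_mul_of_bounded {h : Ω → ℝ} (hm : AEStronglyMeasurable h P) {C : ℝ}
    (hC : ∀ ω, ‖h ω‖ ≤ C) :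
    Continuous fun Z : WeakSpace ℝ (Lp ℝ 1 P) =>
      ∫ ω, ((toWeakSpace ℝ (Lp ℝ 1 P)).symm Z) ω * h ω ∂P := by
  have hi : ∀ Z : Lp ℝ 1 P, Integrable (fun ω => Z ω * h ω) P := fun Z =>
    (L1.integrable_coeFn Z).mul_bdd (c := C) hm (Eventually.of_forall hC)
  let L : Lp ℝ 1 P →ₗ[ℝ] ℝ :=
    { toFun := fun Z => ∫ ω, Z ω * h ω ∂P
      map_add' := fun Z W => by
        rw [← integral_add (hi Z) (hi W)]
        refine integral_congr_ae ?_
        filter_upwards [Lp.coeFn_add Z W] with ω e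
        rw [e, Pi.add_apply, add_mul]
      map_smul' := fun c Z => by
        rw [RingHom.id_apply, smul_eq_mul, ← integral_const_mul]
        refine integral_congr_ae ?_
        filter_upwards [Lp.coeFn_smul c Z] with ω e
        rw [e, Pi.smul_apply, smul_eq_mul, mul_assoc] }
  let M : Lp ℝ 1 P →L[ℝ] ℝ := L.mkContinuous C fun Z => by
    rw [L1.norm_eq_integral_norm, ← integral_const_mul]
    refine (norm_integral_le_integral_norm _).trans ?_
    refine integral_mono (hi Z).norm ((L1.integrable_coeFn Z).norm.const_mul C) fun ω => ?_
    simp only [norm_mul]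
    rw [mul_comm]
    exact mul_le_mul_of_nonneg_right (hC ω) (norm_nonneg _)
  exact WeakBilin.eval_continuous (topDualPairing ℝ (Lp ℝ 1 P)).flip M

theorem integral_measureOf {Z : Lp ℝ 1 P} (hZ : Z ∈ acProb P) (f : Ω → ℝ) :
    ∫ ω, f ω ∂(measureOf Z) = ∫ ω, Z ω * f ω ∂P := by
  rw [measureOf, integral_withDensity_eq_integral_toReal_smul
    (Lp.stronglyMeasurable Z).measurable.ennreal_ofReal (by simp)]
  refine integral_congr_ae ?_
  filter_upwards [hZ.1] with ω hω
  rw [ENNReal.toReal_ofReal hω, smul_eq_mul]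

/-- For `F` in the strong space, `Q ↦ E_Q F` is weakly continuous on `D`. -/
theorem continuousOn_integral_of_mem_strongL1 (hD : D ⊆ acProb P) (hF : F ∈ strongL1 D) :
    ContinuousOn (fun Z : WeakSpace ℝ (Lp ℝ 1 P) =>
      ∫ ω, F ω ∂(measureOf ((toWeakSpace ℝ (Lp ℝ 1 P)).symm Z)))
      (toWeakSpace ℝ (Lp ℝ 1 P) '' D) := by
  let f : ℕ → Ω → ℝ := fun n => {ω | (n : ℝ) < |F ω|}ᶜ.indicator F
  have hfm : ∀ n, AEStronglyMeasurable (f n) P := fun n =>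
    F.aestronglyMeasurable.indicator
      (measurableSet_lt_abs F n).compl
  have hfb : ∀ n ω, ‖f n ω‖ ≤ n := fun n ω => by
    by_cases h : (n : ℝ) < |F ω|
    · simp [f, h]
    · rw [show f n ω = F ω from indicator_of_mem (s := {ω | (n : ℝ) < |F ω|}ᶜ) h _]
      exact not_lt.1 h
  -- Truncations of `F` give weakly continuous functionals, and the definition of the strong space
  -- says exactly that the truncation error is uniform over `D`.
  refine TendstoUniformlyOn.continuousOn (p := atTop) (F := fun (n : ℕ) Z =>
    ∫ ω, ((toWeakSpace ℝ (Lp ℝ 1 P)).symm Z) ω * f n ω ∂P) ?_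
    (Eventually.of_forall fun n =>
      (continuous_integral_mul_of_bounded (hfm n) (hfb n)).continuousOn).frequently
  rw [Metric.tendstoUniformlyOn_iff]
  intro ε hε
  filter_upwards [(tendsto_order.1 hF).2 (ENNReal.ofReal ε) (by simpa using hε)] with n hn
  rintro _ ⟨Z, hZ, rfl⟩
  have := isProbabilityMeasure_measureOf (hD hZ)
  have hms := measurableSet_lt_abs F n
  have hi := integrable_of_mem_strongL1 hD hF hZ
  simp only [LinearEquiv.symm_apply_apply]
  rw [← integral_measureOf (hD hZ), Real.dist_eq, integral_indicator hms.compl,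
    ← integral_add_compl hms hi, add_sub_cancel_right, ← Real.norm_eq_abs]
  refine (norm_integral_le_lintegral_norm _).trans_lt ?_
  refine ENNReal.toReal_lt_of_lt_ofReal (lt_of_le_of_lt ?_ hn)
  exact le_iSup₂ (f := fun (Z : Lp ℝ 1 P) (_ : Z ∈ D) =>
    ∫⁻ ω in {ω | (n : ℝ) < |F ω|}, ENNReal.ofReal |F ω| ∂(measureOf Z)) Z hZ

end StrongL1

/-! ### The price as `-g v / v` -/

section Price

variable {D : Set (Lp ℝ 1 P)} {A : Set (Ω →ₘ[P] ℝ)} {F : Ω →ₘ[P] ℝ}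

theorem utility_sub_smul_le {C : ℝ}
    (hC : ∀ Z ∈ D, Integrable F (measureOf Z) ∧ |∫ ω, F ω ∂(measureOf Z)| ≤ C)
    (X : Ω →ₘ[P] ℝ) (v w : ℝ) :
    utility D (X - v • F) ≤ utility D (X - w • F) + ((C * |v - w| : ℝ) : EReal) := by
  rw [show X - v • F = X - w • F + (w - v) • F by module]
  refine utility_add_le (fun Z hZ => integrable_smul _ (hC Z hZ).1) fun Z hZ => ?_
  rw [integral_smul_aeeqFun]
  refine (le_abs_self _).trans ?_
  rw [abs_mul, abs_sub_comm w v, mul_comm]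
  exact mul_le_mul_of_nonneg_right (hC Z hZ).2 (abs_nonneg _)

theorem NGD.utility_le (h : NGD D A) {X : Ω →ₘ[P] ℝ} (hX : X ∈ A) : utility D X ≤ 0 :=
  not_lt.1 fun hlt => h ⟨X, hX, hlt⟩

/-- The supremum of `u(X - vF)` over `A` is finite: it is at most `C|v|` by the NGD and at least
`-C|v|` by taking `X = 0`. Describing `g` by its upper bounds keeps later arguments in the reals. -/
theorem exists_isLUB_utility_sub_smul {C : ℝ}
    (hC : ∀ Z ∈ D, Integrable F (measureOf Z) ∧ |∫ ω, F ω ∂(measureOf Z)| ≤ C)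
    (hA0 : (0 : Ω →ₘ[P] ℝ) ∈ A) (hNGD : NGD D A) (v : ℝ) :
    ∃ g : ℝ, ∀ b : ℝ, g ≤ b ↔ ∀ X ∈ A, utility D (X - v • F) ≤ (b : EReal) := by
  set G : EReal := ⨆ X ∈ A, utility D (X - v • F) with hG
  have hle : G ≤ ((C * |v| : ℝ) : EReal) := iSup₂_le fun X hX => by
    have h := utility_sub_smul_le hC X v 0
    rw [zero_smul, sub_zero, sub_zero] at h
    exact h.trans ((add_le_add_left (hNGD.utility_le hX) _).trans_eq (zero_add _))
  have hge : ((-(C * |v|) : ℝ) : EReal) ≤ G := by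
    refine le_trans ?_ (le_iSup₂ (f := fun X (_ : X ∈ A) => utility D (X - v • F)) 0 hA0)
    refine le_iInf₂ fun Z hZ => ?_
    rw [show 0 - v • F = (-v) • F by module, expect_of_integrable (integrable_smul _ (hC Z hZ).1),
      integral_smul_aeeqFun, EReal.coe_le_coe_iff]
    refine (abs_le.1 (?_ : |_| ≤ _)).1
    rw [abs_mul, abs_neg, mul_comm]
    exact mul_le_mul_of_nonneg_right (hC Z hZ).2 (abs_nonneg _)
  refine ⟨G.toReal, fun b => ?_⟩
  rw [← EReal.coe_le_coe_iff, EReal.coe_toReal (ne_top_of_le_ne_top (EReal.coe_ne_top _) hle)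
    (ne_bot_of_le_ne_bot (EReal.coe_ne_bot _) hge), hG, iSup₂_le_iff]

theorem sub_smul_sub_const (X : Ω →ₘ[P] ℝ) (v x : ℝ) :
    X - v • (F - AEEqFun.const Ω x) = X - v • F + AEEqFun.const Ω (v * x) := by
  have : (AEEqFun.const Ω (v * x) : Ω →ₘ[P] ℝ) = v • AEEqFun.const Ω x := rfl
  rw [this]
  module

/-- By cash invariance `x` is admissible iff `u(X - vF) + vx ≤ 0` on `A`, so the admissible prices
form a closed half-line. -/
theorem upperPrice_eq (hD : D ⊆ acProb P) {v g : ℝ} (hv : 0 < v)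
    (hg : ∀ b : ℝ, g ≤ b ↔ ∀ X ∈ A, utility D (X - v • F) ≤ (b : EReal)) :
    upperPrice D A F v = ((-g / v : ℝ) : EReal) := by
  have hset : {x : ℝ | NGD D ((fun X : Ω →ₘ[P] ℝ => X - v • (F - AEEqFun.const Ω x)) '' A)} =
      Iic (-g / v) := by
    ext x
    rw [mem_Iic, le_div_iff₀ hv, le_neg, hg]
    simp only [mem_ofPred_eq, NGD, exists_mem_image, not_exists, not_and, not_lt,
      sub_smul_sub_const, utility_add_const hD]
    refine forall₂_congr fun X _ => ?_
    rw [← EReal.le_sub_iff_add_le (by simp) (by simp), zero_sub, mul_comm, EReal.coe_neg]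
  rw [upperPrice, hset]
  refine le_antisymm (sSup_le ?_) (le_sSup ⟨_, mem_Iic.2 le_rfl, rfl⟩)
  rintro _ ⟨x, hx, rfl⟩
  exact EReal.coe_le_coe_iff.2 hx

end Price

end CoherentPricing

namespace CoherentPricing

/-! ### A minimax alternative for continuous affine functions -/

section Minimax

variable {E : Type*} [AddCommGroup E] [Module ℝ E] [TopologicalSpace E]

/-- Finite alternative: finitely many continuous affine functions on a compact convex set have a
common point of nonpositivity as soon as every nonnegative combination has nonpositive infimum. -/
theorem exists_forall_nonpos_of_fintype {K : Set E} (hK : IsCompact K) (hKc : Convex ℝ K)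
    {ι : Type*} [Fintype ι] {f : ι → E → ℝ} (hf : ∀ i, ContinuousOn (f i) K)
    (hfa : ∀ i, ∀ x ∈ K, ∀ y ∈ K, ∀ a b : ℝ, 0 ≤ a → 0 ≤ b → a + b = 1 →
      f i (a • x + b • y) = a * f i x + b * f i y)
    (h : ∀ w : ι → ℝ, (∀ i, 0 ≤ w i) → ∀ ε > 0, ∃ x ∈ K, ∑ i, w i * f i x < ε) :
    ∃ x ∈ K, ∀ i, f i x ≤ 0 := by
  classical
  by_contra! hne
  -- Without a common point, the compact convex image of `K` misses the nonpositive orthant; a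
  -- separating functional supplies the weights.
  have hdisj : Disjoint (Iic (0 : ι → ℝ)) ((fun x i => f i x) '' K) := by
    rw [Set.disjoint_left]
    rintro _ hc ⟨x, hx, rfl⟩
    obtain ⟨i, hi⟩ := hne x hx
    exact absurd (hc i) (not_le.2 hi)
  have hconv : Convex ℝ ((fun x i => f i x) '' K) := by
    rintro _ ⟨x, hx, rfl⟩ _ ⟨y, hy, rfl⟩ a b ha hb hab
    refine ⟨a • x + b • y, hKc hx hy ha hb hab, ?_⟩
    ext i
    simp [hfa i x hx y hy a b ha hb hab]
  obtain ⟨L, s, t, hs, hst, ht⟩ := geometric_hahn_banach_closed_compact (convex_Iic 0) isClosed_Iic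
    hconv (hK.image_of_continuousOn (continuousOn_pi.2 hf)) hdisj
  have hs0 : 0 < s := by simpa using hs 0 (by simp)
  have hL : ∀ c : ι → ℝ, L c = ∑ i, L (Pi.single i 1) * c i := fun c => by
    refine (L.toLinearMap.pi_apply_eq_sum_univ c).trans (Finset.sum_congr rfl fun i _ => ?_)
    rw [smul_eq_mul, mul_comm]
    refine congrArg (fun d => L d * c i) ?_
    ext j
    simp [Pi.single_apply, eq_comm]
  have hw : ∀ i, 0 ≤ L (Pi.single i 1) := fun i => by
    by_contra! hi
    -- If a weight were negative, this multiple of the basis vector would lie in the orthant with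
    -- `L` equal to `s`, where `L < s`.
    have hmem : ((s / L (Pi.single i 1)) • Pi.single i (1 : ℝ) : ι → ℝ) ∈ Iic (0 : ι → ℝ) := by
      intro j
      rw [Pi.smul_apply, smul_eq_mul]
      refine mul_nonpos_of_nonpos_of_nonneg (div_nonpos_of_nonneg_of_nonpos hs0.le hi.le) ?_
      by_cases hij : j = i
      · subst hij; simp
      · simp [hij]
    have := hs _ hmem
    rw [map_smul, smul_eq_mul, div_mul_cancel₀ _ hi.ne] at this
    exact lt_irrefl _ this
  obtain ⟨x, hx, hlt⟩ := h (fun i => L (Pi.single i 1)) hw t (hs0.trans hst)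
  have := ht _ ⟨x, hx, rfl⟩
  rw [hL] at this
  exact lt_asymm this hlt

/-- An arbitrary family of continuous affine functions on a compact convex set has a common point
of nonpositivity as soon as every finite nonnegative combination has nonpositive infimum. -/
theorem exists_forall_nonpos {K : Set E} (hK : IsCompact K) (hKc : Convex ℝ K)
    {ι : Type*} {f : ι → E → ℝ} (hf : ∀ i, ContinuousOn (f i) K)
    (hfa : ∀ i, ∀ x ∈ K, ∀ y ∈ K, ∀ a b : ℝ, 0 ≤ a → 0 ≤ b → a + b = 1 →
      f i (a • x + b • y) = a * f i x + b * f i y)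
    (h : ∀ (t : Finset ι) (w : ι → ℝ), (∀ i, 0 ≤ w i) → ∀ ε > 0,
      ∃ x ∈ K, ∑ i ∈ t, w i * f i x < ε) :
    ∃ x ∈ K, ∀ i, f i x ≤ 0 := by
  classical
  have : CompactSpace K := isCompact_iff_compactSpace.1 hK
  have key : (⋂ i, {x : K | f i x ≤ 0}).Nonempty := by
    -- By compactness, finitely many constraints suffice.
    refine CompactSpace.iInter_nonempty
      (fun i => isClosed_le (hf i).domRestrict continuous_const) fun t => ?_
    obtain ⟨x, hx, hle⟩ := exists_forall_nonpos_of_fintype hK hKc (ι := t)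
      (f := fun i => f i) (fun i => hf i) (fun i => hfa i) fun w hw ε hε => by
        obtain ⟨x, hx, hlt⟩ := h t (fun i => if hi : i ∈ t then w ⟨i, hi⟩ else 0)
          (fun i => by split_ifs <;> simp [hw]) ε hε
        refine ⟨x, hx, ?_⟩
        rw [← Finset.sum_coe_sort] at hlt
        simpa using hlt
    exact ⟨⟨x, hx⟩, mem_iInter₂.2 fun i hi => hle ⟨i, hi⟩⟩
  obtain ⟨x, hx⟩ := key
  exact ⟨x, x.2, fun i => mem_iInter.1 hx i⟩

end Minimax

/-! ### Existence of a risk-neutral measure in `D` -/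

variable {Ω : Type*} [MeasurableSpace Ω] {P : Measure Ω}
  {D : Set (Lp ℝ 1 P)} {A : Set (Ω →ₘ[P] ℝ)} {F : Ω →ₘ[P] ℝ}

/-- A nonnegative combination of the expectations of members of `A' ⊆ A` and of `y - F` is the
expectation of a combination of a single member of `A` and `y - F`. -/
theorem exists_combination_eq (hD : D ⊆ acProb P) (hA : Convex ℝ A)
    (hA0 : (0 : Ω →ₘ[P] ℝ) ∈ A) {A' : Set (Ω →ₘ[P] ℝ)} (hA' : A' ⊆ strongL1 D ∩ A)
    {e : Lp ℝ 1 P → ℝ}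
    (t : Finset (Option A')) (w : Option A' → ℝ) (hw : ∀ i, 0 ≤ w i) :
    ∃ X ∈ A, ∃ l v : ℝ, 0 ≤ l ∧ 0 ≤ v ∧ ∀ Z ∈ D, Integrable X (measureOf Z) ∧
      ∑ i ∈ t, w i * i.elim (e Z) (fun Y : A' => ∫ ω, (Y : Ω →ₘ[P] ℝ) ω ∂(measureOf Z)) =
        l * ∫ ω, X ω ∂(measureOf Z) + v * e Z := by
  classical
  induction t using Finset.induction_on with
  | empty =>
    refine ⟨0, hA0, 0, 0, le_rfl, le_rfl, fun Z hZ => ⟨?_, by simp⟩⟩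
    exact integrable_const_aeeqFun (hD hZ) 0
  | insert i t hi ih =>
    obtain ⟨X, hX, l, v, hl, hv, h⟩ := ih
    rcases i with _ | Y
    · refine ⟨X, hX, l, v + w none, hl, add_nonneg hv (hw _), fun Z hZ => ⟨(h Z hZ).1, ?_⟩⟩
      rw [Finset.sum_insert hi, (h Z hZ).2, Option.elim_none]
      ring
    -- Merging `X` and `Y` into one member of `A` divides by the total weight; if that is zero, `Y`
    -- contributes nothing.
    · rcases (add_nonneg hl (hw (some Y))).eq_or_lt with h0 | h0
      · refine ⟨X, hX, l, v, hl, hv, fun Z hZ => ⟨(h Z hZ).1, ?_⟩⟩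
        have : w (some Y) = 0 := by linarith [hw (some Y)]
        rw [Finset.sum_insert hi, (h Z hZ).2, this, zero_mul, zero_add]
      · refine ⟨(l / (l + w (some Y))) • X + (w (some Y) / (l + w (some Y))) • (Y : Ω →ₘ[P] ℝ),
          hA hX (hA' Y.2).2 (div_nonneg hl h0.le) (div_nonneg (hw _) h0.le) ?_, l + w (some Y), v,
          h0.le, hv, fun Z hZ => ?_⟩
        · rw [← add_div, div_self h0.ne']
        · have i₁ := integrable_smul (l / (l + w (some Y))) (h Z hZ).1
          have i₂ := integrable_smul (w (some Y) / (l + w (some Y)))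
            (integrable_of_mem_strongL1 hD (hA' Y.2).1 hZ)
          refine ⟨integrable_add i₁ i₂, ?_⟩
          rw [Finset.sum_insert hi, (h Z hZ).2, Option.elim_some, integral_add_aeeqFun i₁ i₂,
            integral_smul_aeeqFun, integral_smul_aeeqFun]
          field_simp
          ring

/-- If no position `X - v (F - y)` with `X ∈ A` and `v ≥ 0` is a good deal, some measure in `D`
is risk-neutral for `A'` and prices `F` at least at `y`. -/
theorem exists_mem_riskNeutral (hD : IsDeterminingSet D) (hDc : IsWeaklyCompact D)
    (hA : Convex ℝ A) (hA0 : (0 : Ω →ₘ[P] ℝ) ∈ A) (hF : F ∈ strongL1 D)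
    {A' : Set (Ω →ₘ[P] ℝ)} (hA' : A' ⊆ strongL1 D ∩ A) {y : ℝ}
    (hy : ∀ X ∈ A, ∀ v : ℝ, 0 ≤ v → utility D (X - v • F) ≤ ((-(v * y) : ℝ) : EReal)) :
    ∃ Z ∈ D ∩ riskNeutral A', y ≤ ∫ ω, F ω ∂(measureOf Z) := by
  have hDs := hD.subset_acProb
  let T := toWeakSpace ℝ (Lp ℝ 1 P)
  -- Index `none` encodes the requirement `y ≤ E_Q F`; the other indices encode risk neutrality for
  -- `A'`.
  suffices hmin : ∃ Z ∈ T '' D, ∀ i : Option A', i.elim (y - ∫ ω, F ω ∂(measureOf (T.symm Z)))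
      (fun Y : A' => ∫ ω, (Y : Ω →ₘ[P] ℝ) ω ∂(measureOf (T.symm Z))) ≤ 0 by
    obtain ⟨_, ⟨Z, hZ, rfl⟩, hle⟩ := hmin
    simp only [T, LinearEquiv.symm_apply_apply] at hle
    refine ⟨Z, ⟨hZ, hDs hZ, fun X hX => ?_⟩, by simpa using hle none⟩
    rw [expect_of_integrable (integrable_of_mem_strongL1 hDs (hA' hX).1 hZ)]
    exact_mod_cast hle (some ⟨X, hX⟩)
  refine exists_forall_nonpos (K := T '' D) hDc
    (hD.convex.linear_image T.toLinearMap) (ι := Option A')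
    (f := fun i Z => i.elim (y - ∫ ω, F ω ∂(measureOf (T.symm Z)))
      (fun Y : A' => ∫ ω, (Y : Ω →ₘ[P] ℝ) ω ∂(measureOf (T.symm Z)))) ?_ ?_ ?_
  · rintro (_ | Y)
    · exact continuousOn_const.sub (continuousOn_integral_of_mem_strongL1 hDs hF)
    · exact continuousOn_integral_of_mem_strongL1 hDs (hA' Y.2).1
  · have key : ∀ X ∈ strongL1 D, ∀ Z ∈ D, ∀ W ∈ D, ∀ a b : ℝ, 0 ≤ a → 0 ≤ b →
        ∫ ω, X ω ∂(measureOf (a • Z + b • W)) =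
          a * ∫ ω, X ω ∂(measureOf Z) + b * ∫ ω, X ω ∂(measureOf W) :=
      fun X hX Z hZ W hW a b ha hb => integral_measureOf_combination (hDs hZ) (hDs hW) ha hb
        (integrable_of_mem_strongL1 hDs hX hZ) (integrable_of_mem_strongL1 hDs hX hW)
    rintro (_ | Y) _ ⟨Z, hZ, rfl⟩ _ ⟨W, hW, rfl⟩ a b ha hb hab
    · simp only [Option.elim_none, map_add, map_smul, LinearEquiv.symm_apply_apply,
        key F hF Z hZ W hW a b ha hb]
      linear_combination -y * hab
    · simp only [Option.elim_some, map_add, map_smul, LinearEquiv.symm_apply_apply,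
        key Y (hA' Y.2).1 Z hZ W hW a b ha hb]
  · intro t w hw ε hε
    obtain ⟨X, hX, l, v, hl, hv, h⟩ := exists_combination_eq hDs hA hA0 hA'
      (e := fun Z => y - ∫ ω, F ω ∂(measureOf Z)) t w hw
    suffices ∃ Z ∈ D, l * ∫ ω, X ω ∂(measureOf Z) + v * (y - ∫ ω, F ω ∂(measureOf Z)) < ε by
      obtain ⟨Z, hZ, hlt⟩ := this
      refine ⟨T Z, mem_image_of_mem T hZ, ?_⟩
      simp only [LinearEquiv.symm_apply_apply]
      rwa [(h Z hZ).2]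
    have key : ∀ X ∈ A, (∀ Z ∈ D, Integrable X (measureOf Z)) → ∀ v : ℝ, 0 ≤ v → ∀ δ > 0, ∃ Z ∈ D,
        ∫ ω, X ω ∂(measureOf Z) + v * (y - ∫ ω, F ω ∂(measureOf Z)) < δ := by
      intro X hX hXi v hv δ hδ
      have hlt : utility D (X - v • F) < ((δ - v * y : ℝ) : EReal) :=
        (hy X hX v hv).trans_lt (EReal.coe_lt_coe_iff.2 (by linarith))
      simp only [utility, iInf_lt_iff] at hlt
      obtain ⟨Z, hZ, hlt⟩ := hlt
      have hFi := integrable_smul (-v) (integrable_of_mem_strongL1 hDs hF hZ)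
      rw [show X - v • F = X + (-v) • F by module,
        expect_of_integrable (integrable_add (hXi Z hZ) hFi), integral_add_aeeqFun (hXi Z hZ) hFi,
        integral_smul_aeeqFun, EReal.coe_lt_coe_iff] at hlt
      exact ⟨Z, hZ, by linarith⟩
    -- With `l = 0` the position `0 ∈ A` serves; otherwise dividing by `l` reduces to a member of
    -- `A` with volume `v / l` and tolerance `ε / l`.
    rcases hl.eq_or_lt with rfl | hl
    · obtain ⟨Z, hZ, hlt⟩ := key 0 hA0 (fun Z hZ => integrable_const_aeeqFun (hDs hZ) 0) v hv ε hε
      refine ⟨Z, hZ, ?_⟩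
      have h0 : ∫ ω, (0 : Ω →ₘ[P] ℝ) ω ∂(measureOf Z) = 0 := integral_const_aeeqFun (hDs hZ) 0
      rw [h0] at hlt
      rwa [zero_mul]
    · obtain ⟨Z, hZ, hlt⟩ := key X hX (fun Z hZ => (h Z hZ).1) (v / l) (by positivity) (ε / l)
        (by positivity)
      refine ⟨Z, hZ, ?_⟩
      rw [lt_div_iff₀ hl] at hlt
      refine lt_of_eq_of_lt ?_ hlt
      field_simp

end CoherentPricing

/-! ### Regularity and bounds for `g` -/

namespace CoherentPricing

theorem le_coe_of_abs_le {x : EReal} {c : ℝ≥0∞} (hc : c ≠ ⊤) (h : x.abs ≤ c) :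
    x ≤ (c.toReal : EReal) := by
  induction x with
  | bot => exact bot_le
  | top => exact absurd (top_le_iff.1 (by simpa using h)) hc
  | coe x =>
    rw [EReal.abs_def] at h
    exact EReal.coe_le_coe_iff.2 ((le_abs_self x).trans ((ENNReal.ofReal_le_iff_le_toReal hc).1 h))

theorem exists_tendsto_atTop_of_monotoneOn {f : ℝ → EReal} (hf : MonotoneOn f (Ioi 0)) :
    ∃ l, Tendsto f atTop (𝓝 l) := by
  -- Freezing the argument below `1` makes the function monotone on all of `ℝ` without changing it
  -- near infinity.
  refine ⟨_, (tendsto_atTop_iSup (f := fun v => f (max v 1)) fun v w hvw => ?_).congr' ?_⟩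
  · exact hf (mem_Ioi.2 (lt_max_of_lt_right one_pos)) (mem_Ioi.2 (lt_max_of_lt_right one_pos))
      (max_le_max_right 1 hvw)
  · filter_upwards [eventually_ge_atTop 1] with v hv
    rw [max_eq_left hv]

variable {Ω : Type*} [MeasurableSpace Ω] {P : Measure Ω}
  {D : Set (Lp ℝ 1 P)} {A : Set (Ω →ₘ[P] ℝ)} {F : Ω →ₘ[P] ℝ}

section Penalty

variable {g : ℝ → ℝ}

theorem continuous_penalty {C : ℝ}
    (hC : ∀ Z ∈ D, Integrable F (measureOf Z) ∧ |∫ ω, F ω ∂(measureOf Z)| ≤ C)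
    (hg : ∀ v b : ℝ, g v ≤ b ↔ ∀ X ∈ A, utility D (X - v • F) ≤ (b : EReal)) :
    Continuous g := by
  have h : ∀ v w, g v ≤ g w + C * |v - w| := fun v w => (hg v _).2 fun X hX => by
    rw [EReal.coe_add]
    exact (utility_sub_smul_le hC X v w).trans (add_le_add_left ((hg w _).1 le_rfl X hX) _)
  refine (LipschitzWith.of_dist_le_mul (K := C.toNNReal) fun v w => ?_).continuous
  have hle : C * |v - w| ≤ C.toNNReal * dist v w :=
    mul_le_mul_of_nonneg_right (Real.le_coe_toNNReal C) (abs_nonneg _)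
  rw [Real.dist_eq, abs_le]
  have h₁ := h v w
  have h₂ := h w v
  rw [abs_sub_comm] at h₂
  constructor <;> linarith

/-- Shrinking `X` towards zero keeps `(v / w) X` in `A`, and `X - wF` is `w / v` times `(v / w) X -
vF`; positive homogeneity gives `g w ≤ (w / v) g v`. -/
theorem penalty_div_le (hA : Convex ℝ A) (hA0 : (0 : Ω →ₘ[P] ℝ) ∈ A)
    (hg : ∀ v b : ℝ, g v ≤ b ↔ ∀ X ∈ A, utility D (X - v • F) ≤ (b : EReal)) {v w : ℝ}
    (hv : 0 < v) (hvw : v ≤ w) : g w / w ≤ g v / v := by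
  have hw : 0 < w := hv.trans_le hvw
  have h : g w ≤ w / v * g v := (hg w _).2 fun X hX => by
    have hX' : (v / w) • X ∈ A := by
      have := hA hX hA0 (a := v / w) (b := 1 - v / w) (by positivity)
        (sub_nonneg.2 ((div_le_one hw).2 hvw)) (by ring)
      simpa using this
    rw [show X - w • F = (w / v) • ((v / w) • X - v • F) by
      rw [smul_sub, smul_smul, smul_smul, div_mul_div_cancel₀ hv.ne', div_self hw.ne', one_smul,
        div_mul_cancel₀ _ hv.ne'], EReal.coe_mul]
    refine (utility_smul_le (div_pos hw hv) _).trans ?_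
    exact mul_le_mul_of_nonneg_left ((hg v _).1 le_rfl _ hX')
      (by exact_mod_cast (div_pos hw hv).le)
  rw [div_le_iff₀ hw]
  exact h.trans_eq (by ring)

/-- The infimum defining `u` is bounded by its value at a single `Q`. With `K = 0` this serves
risk-neutral measures; with a uniform bound it serves the limit at infinity. -/
theorem penalty_le_of_forall_expect_le {Z : Lp ℝ 1 P} (hZ : Z ∈ D)
    (hF : Integrable F (measureOf Z))
    (hg : ∀ v b : ℝ, g v ≤ b ↔ ∀ X ∈ A, utility D (X - v • F) ≤ (b : EReal)) {K : ℝ}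
    (hK : ∀ X ∈ A, expect Z X ≤ (K : EReal)) (v : ℝ) :
    g v ≤ K - v * ∫ ω, F ω ∂(measureOf Z) := by
  refine (hg v _).2 fun X hX => (iInf₂_le Z hZ).trans ?_
  rw [show X - v • F = X + (-v) • F by module, expect_add X (integrable_smul _ hF),
    integral_smul_aeeqFun, sub_eq_add_neg, EReal.coe_add, neg_mul]
  exact add_le_add_left (hK X hX) _

theorem le_penalty (hi : ∀ Z ∈ D, Integrable F (measureOf Z)) (hA0 : (0 : Ω →ₘ[P] ℝ) ∈ A)
    (hg : ∀ v b : ℝ, g v ≤ b ↔ ∀ X ∈ A, utility D (X - v • F) ≤ (b : EReal)) {z v : ℝ}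
    (hv : 0 < v) (hz : ∀ Z ∈ D, ∫ ω, F ω ∂(measureOf Z) ≤ z) : -(v * z) ≤ g v := by
  have h := (hg v _).1 le_rfl 0 hA0
  rw [← EReal.coe_le_coe_iff]
  refine le_trans (le_iInf₂ fun Z hZ => ?_) h
  rw [show 0 - v • F = (-v) • F by module, expect_of_integrable (integrable_smul _ (hi Z hZ)),
    integral_smul_aeeqFun, EReal.coe_le_coe_iff, neg_mul]
  exact neg_le_neg (mul_le_mul_of_nonneg_left (hz Z hZ) hv.le)

end Penalty

end CoherentPricing

/-! ### The three assertions -/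

open CoherentPricing

theorem mainTheorem11 {Ω : Type*} [MeasurableSpace Ω] (P : Measure Ω) [IsProbabilityMeasure P]
    (D : Set (Lp ℝ 1 P)) (hD : CoherentPricing.IsDeterminingSet D)
    (hDc : CoherentPricing.IsWeaklyCompact D)
    (A : Set (Ω →ₘ[P] ℝ)) (hA : Convex ℝ A) (hA0 : (0 : Ω →ₘ[P] ℝ) ∈ A)
    (hNGD : CoherentPricing.NGD D A)
    (F : Ω →ₘ[P] ℝ) (hF : F ∈ CoherentPricing.strongL1 D) :
    -- (i) the upper price is finite, increasing and continuous on `(0, ∞)`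
    ((∀ v ∈ Ioi (0 : ℝ), CoherentPricing.upperPrice D A F v ≠ ⊥ ∧
        CoherentPricing.upperPrice D A F v ≠ ⊤) ∧
      MonotoneOn (CoherentPricing.upperPrice D A F) (Ioi 0) ∧
      ContinuousOn (CoherentPricing.upperPrice D A F) (Ioi 0)) ∧
    -- (ii) the limit at zero
    (CoherentPricing.IsConsistent D A →
      Tendsto (CoherentPricing.upperPrice D A F) (𝓝[>] 0)
        (𝓝 (⨆ Z ∈ D ∩ CoherentPricing.riskNeutral A, CoherentPricing.expect Z F))) ∧
    -- (iii) the limit at infinity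
    (∃ l : EReal, Tendsto (CoherentPricing.upperPrice D A F) atTop (𝓝 l) ∧
      l ≤ ⨆ Z ∈ D, CoherentPricing.expect Z F) ∧
    ((⨆ X ∈ A, ⨆ Z ∈ D, (CoherentPricing.expect Z X).abs) < ⊤ →
      Tendsto (CoherentPricing.upperPrice D A F) atTop
        (𝓝 (⨆ Z ∈ D, CoherentPricing.expect Z F))) := by
  have hDs := hD.subset_acProb
  obtain ⟨C, -, hC⟩ := exists_bound_of_mem_strongL1 hDs hF
  choose g hg using exists_isLUB_utility_sub_smul hC hA0 hNGD
  have hV : ∀ v ∈ Ioi (0 : ℝ), upperPrice D A F v = ((-g v / v : ℝ) : EReal) :=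
    fun v hv => upperPrice_eq hDs hv (hg v)
  have hmono : MonotoneOn (upperPrice D A F) (Ioi 0) := fun v hv w hw hvw => by
    rw [hV v hv, hV w hw, EReal.coe_le_coe_iff, neg_div, neg_div, neg_le_neg_iff]
    exact penalty_div_le hA hA0 hg hv hvw
  have hexp : ∀ Z ∈ D, expect Z F = ((∫ ω, F ω ∂(measureOf Z) : ℝ) : EReal) :=
    fun Z hZ => expect_of_integrable (hC Z hZ).1
  have hupper : ∀ v ∈ Ioi (0 : ℝ), upperPrice D A F v ≤ ⨆ Z ∈ D, expect Z F := fun v hv => by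
    refine EReal.le_of_forall_lt_iff_le.1 fun z hz => ?_
    have hz' : ∀ Z ∈ D, ∫ ω, F ω ∂(measureOf Z) ≤ z := fun Z hZ => by
      rw [← EReal.coe_le_coe_iff, ← hexp Z hZ]
      exact (le_iSup₂ (f := fun Z (_ : Z ∈ D) => expect Z F) Z hZ).trans hz.le
    rw [hV v hv, EReal.coe_le_coe_iff, div_le_iff₀ hv]
    linarith [le_penalty (fun Z hZ => (hC Z hZ).1) hA0 hg hv hz']
  have hlim_le : ∀ l : EReal, Tendsto (upperPrice D A F) atTop (𝓝 l) →
      l ≤ ⨆ Z ∈ D, expect Z F := fun l hl =>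
    le_of_tendsto hl ((eventually_gt_atTop 0).mono hupper)
  refine ⟨⟨fun v hv => ?_, hmono, ?_⟩, ?_, ?_, fun hK => ?_⟩
  · rw [hV v hv]
    exact ⟨EReal.coe_ne_bot _, EReal.coe_ne_top _⟩
  · refine ContinuousOn.congr (continuous_coe_real_ereal.comp_continuousOn ?_) hV
    exact (continuous_penalty hC hg).neg.continuousOn.div continuousOn_id fun v hv => ne_of_gt hv
  · rintro ⟨A', hA', hR⟩
    -- By monotonicity the limit at zero is the infimum of all prices.
    have hlim := hmono.tendsto_nhdsGT (OrderBot.bddBelow _)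
    suffices h : sInf (upperPrice D A F '' Ioi 0) =
        ⨆ Z ∈ D ∩ riskNeutral A, expect Z F by rwa [h] at hlim
    refine le_antisymm (EReal.ge_of_forall_gt_iff_ge.1 fun y hy => ?_) ?_
    · obtain ⟨Z, hZ, hle⟩ := exists_mem_riskNeutral hD hDc hA hA0 hF hA' (y := y)
        fun X hX v hv => by
          -- Volume zero is the NGD for `A` itself; for positive volume, `y` lies below every price.
          rcases hv.eq_or_lt with rfl | hv
          · simpa using hNGD.utility_le hX
          · refine (hg v _).1 ?_ X hX
            have h := hy.le.trans (sInf_le (mem_image_of_mem _ (mem_Ioi.2 hv)))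
            rw [hV v hv, EReal.coe_le_coe_iff, le_div_iff₀ hv] at h
            linarith
      rw [← hR] at hZ
      refine le_trans ?_ (le_iSup₂ (f := fun Z (_ : Z ∈ D ∩ riskNeutral A) => expect Z F) Z hZ)
      rw [hexp Z hZ.1]
      exact EReal.coe_le_coe_iff.2 hle
    · refine iSup₂_le fun Z hZ => le_sInf ?_
      rintro _ ⟨v, hv, rfl⟩
      have h := penalty_le_of_forall_expect_le hZ.1 (hC Z hZ.1).1 hg (K := 0) hZ.2.2 v
      rw [hexp Z hZ.1, hV v hv, EReal.coe_le_coe_iff, le_div_iff₀ hv]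
      linarith
  · obtain ⟨l, hl⟩ := exists_tendsto_atTop_of_monotoneOn hmono
    exact ⟨l, hl, hlim_le l hl⟩
  · set K := ⨆ X ∈ A, ⨆ Z ∈ D, (expect Z X).abs with hKdef
    have hb : ∀ Z ∈ D, ∀ X ∈ A, expect Z X ≤ (K.toReal : EReal) := fun Z hZ X hX =>
      le_coe_of_abs_le hK.ne <|
        (le_iSup₂ (f := fun Z (_ : Z ∈ D) => (expect Z X).abs) Z hZ).trans
          (le_iSup₂ (f := fun X (_ : X ∈ A) => ⨆ Z ∈ D, (expect Z X).abs) X hX)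
    obtain ⟨l, hl⟩ := exists_tendsto_atTop_of_monotoneOn hmono
    suffices h : ⨆ Z ∈ D, expect Z F ≤ l by rwa [h.antisymm (hlim_le l hl)]
    refine iSup₂_le fun Z hZ => ?_
    have hreal : Tendsto (fun v : ℝ => ∫ ω, F ω ∂(measureOf Z) - K.toReal / v) atTop
        (𝓝 (∫ ω, F ω ∂(measureOf Z))) := by
      have h₀ : Tendsto (fun v : ℝ => K.toReal / v) atTop (𝓝 0) :=
        tendsto_const_nhds.div_atTop tendsto_id
      simpa using h₀.const_sub (∫ ω, F ω ∂(measureOf Z))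
    rw [hexp Z hZ]
    refine le_of_tendsto_of_tendsto ((continuous_coe_real_ereal.tendsto _).comp hreal) hl ?_
    filter_upwards [eventually_gt_atTop 0] with v hv
    -- What remains is `v E_Q F - K ≤ -g v`, the single-measure bound on `g`.
    rw [Function.comp_apply, hV v hv, EReal.coe_le_coe_iff, le_div_iff₀ hv, sub_mul,
      div_mul_cancel₀ _ hv.ne']
    linarith [penalty_le_of_forall_expect_le hZ (hC Z hZ).1 hg (hb Z hZ) v]
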